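/- Let $\mathbf{X}$ be a Euclidean space. The Clarke subdifferential $\partial f(x)$ of $f\colon\mathbf{X}\to\mathbb{R}$ at $x$ is the closed convex hull of all limits $\lim_r \nabla f(x_r)$ along sequences $x_r\to x$ of points of differentiability. For $\epsilon\ge 0$, the Goldstein subgradient $g_\epsilon(x)$ is the shortest vector in $\mathrm{conv}\,\bigcup_{|y-x|\le\epsilon}\partial f(y)$. A function $f\colon\mathbf{X}\to\mathbb{R}$ is a strong $\mathcal{C}^2$ max function at $\bar x$ if: (i) $0\in\mathrm{ri}\,\partial f(\bar x)$, where $\mathrm{ri}$ denotes the relative interior; (ii) there is a constant $\kappa>0$ with $f(x)-f(\bar x)\ge\frac{\kappa}{2}|x-\bar x|^2$ for all $x$ near $\bar x$; (iii) for some nonempty finite set $I$ and $\mathcal{C}^2$-smooth functions $f_i\colon\mathbf{X}\to\mathbb{R}$ $(i\in I)$ we have $f(x)=\max_{i\in I}f_i(x)$ for all $x$ near $\bar x$, the values $f_i(\bar x)$ are all equal, and the gradients $\nabla f_i(\bar x)$ $(i\in I)$ are affinely independent. Its active manifold is the set $\mathcal{M}$ of points $x\in\mathbf{X}$ where the values $f_i(x)$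 $(i\in I)$ are all equal. Denote by $P_{\mathcal M}(x)$ the nearest point to $x$ in $\mathcal M$, and by $\nabla_{\mathcal M}f(p)$ the Riemannian gradient at $p\in\mathcal M$ of the restriction $f|_{\mathcal M}$, with respect to the metric induced from $\mathbf{X}$: the tangent vector $v$ to $\mathcal M$ at $p$ such that $\frac{d}{dt}f(\gamma(t))\big|_{t=0}=\langle v,\gamma'(0)\rangle$ for every $\mathcal{C}^1$ curve $\gamma$ in $\mathcal M$ with $\gamma(0)=p$. Theorem. Let $f$ be a strong $\mathcal{C}^2$ max function at a local minimizer $\bar x$, with active manifold $\mathcal M$. Then there exist a constant $\mu>0$ and constants $K$ and $\delta>0$ such that, for all $x\in\mathbf{X}$ with $|x-\bar x|<\delta$ and all $\epsilon$ with $0\le\epsilon<\delta$, the Goldstein subgradient $g_\epsilon(x)$, the nearest point $P_{\mathcal M}(x)$ and the Riemannian gradient $\nabla_{\mathcal M}f(P_{\mathcal M}(x))$ exist and are unique, and $$|g_\epsilon(x)|\le\mu\quad\Longrightarrow\quad |x-P_{\mathcal M}(x)|\le K\epsilon\ \text{ and }\ \big|g_\epsilon(x)-\nabla_{\mathcal M}f(P_{\mathcal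 M}(x))\big|\le K\epsilon .$$ -/

import Mathlib

open Set Filter Topology

/-- Limits of gradients `lim ∇ f (y r)` along sequences `y r → x` of points at which `f` is
differentiable. -/
def limitingGradients {E : Type*} [NormedAddCommGroup E] [InnerProductSpace ℝ E]
    [CompleteSpace E] (f : E → ℝ) (x : E) : Set E :=
  {v | ∃ y u : ℕ → E, (∀ r, HasGradientAt f (u r) (y r)) ∧
    Tendsto y atTop (𝓝 x) ∧ Tendsto u atTop (𝓝 v)}

/-- The Clarke subdifferential: the closed convex hull of the limiting gradients. -/
def clarkeSubdifferential {E : Type*} [NormedAddCommGroup E] [InnerProductSpace ℝ E]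
    [CompleteSpace E] (f : E → ℝ) (x : E) : Set E :=
  closure (convexHull ℝ (limitingGradients f x))

/-- The Goldstein subdifferential of radius `ε`: the convex hull of all Clarke subgradients at
points of the closed ball of radius `ε` around `x`. -/
def goldsteinSubdifferential {E : Type*} [NormedAddCommGroup E] [InnerProductSpace ℝ E]
    [CompleteSpace E] (f : E → ℝ) (ε : ℝ) (x : E) : Set E :=
  convexHull ℝ (⋃ y ∈ Metric.closedBall x ε, clarkeSubdifferential f y)

/-- `g` is the Goldstein subgradient of radius `ε` at `x`: the shortest vector of the Goldstein
subdifferential. -/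
def IsGoldsteinSubgradient {E : Type*} [NormedAddCommGroup E] [InnerProductSpace ℝ E]
    [CompleteSpace E] (f : E → ℝ) (ε : ℝ) (x g : E) : Prop :=
  g ∈ goldsteinSubdifferential f ε x ∧ ∀ v ∈ goldsteinSubdifferential f ε x, ‖g‖ ≤ ‖v‖

/-- `f x - f x̄ ≥ (δ / 2) |x - x̄| ^ 2` for all `x` near `x̄`, for some constant `δ > 0`. -/
def GrowsQuadraticallyAt {E : Type*} [NormedAddCommGroup E] (f : E → ℝ) (xbar : E) : Prop :=
  ∃ δ : ℝ, 0 < δ ∧ ∀ᶠ x in 𝓝 xbar, δ / 2 * ‖x - xbar‖ ^ 2 ≤ f x - f xbar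

/-- `f` is a strong `C²` max function at `xbar`, as witnessed by the finite family `F`. -/
structure IsStrongC2MaxFunction {E : Type*} [NormedAddCommGroup E] [InnerProductSpace ℝ E]
    [CompleteSpace E] {ι : Type*} [Finite ι] (f : E → ℝ) (F : ι → E → ℝ) (xbar : E) : Prop where
  /-- `xbar` is Clarke critical -/
  critical : (0 : E) ∈ clarkeSubdifferential f xbar
  /-- `xbar` is nondegenerate: zero is in the relative interior of the subdifferential -/
  nondegenerate : (0 : E) ∈ intrinsicInterior ℝ (clarkeSubdifferential f xbar)
  growth : GrowsQuadraticallyAt f xbar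
  smooth : ∀ i, ContDiff ℝ 2 (F i)
  /-- `f x = max_i F i x` near `xbar` (in particular the family is not empty) -/
  eq_max : ∀ᶠ x in 𝓝 xbar, IsGreatest (range fun i => F i x) (f x)
  active : ∀ i j, F i xbar = F j xbar
  affineIndependent : AffineIndependent ℝ fun i => gradient (F i) xbar

/-- The active manifold: the points where all the functions of the family have the same value. -/
def activeManifold {E : Type*} {ι : Type*} (F : ι → E → ℝ) : Set E :=
  {x | ∀ i j, F i x = F j x}

/-- `p` is a nearest point to `x` in `M`. -/
def IsNearestPoint {E : Type*} [NormedAddCommGroup E] (M : Set E) (x p : E) : Prop :=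
  p ∈ M ∧ ∀ q ∈ M, ‖x - p‖ ≤ ‖x - q‖

/-- `γ` is a `C¹` curve in `M`, defined around time `0`, passing through `p` at time `0`. -/
structure IsCurveThrough {E : Type*} [NormedAddCommGroup E] [NormedSpace ℝ E]
    (M : Set E) (p : E) (γ : ℝ → E) : Prop where
  contDiffAt : ContDiffAt ℝ 1 γ 0
  map_zero : γ 0 = p
  mem : ∀ᶠ t in 𝓝 (0 : ℝ), γ t ∈ M

/-- The tangent space to an embedded manifold `M` at `p`: the velocities of the curves in `M`
through `p`. -/
def tangentVectors {E : Type*} [NormedAddCommGroup E] [NormedSpace ℝ E]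
    (M : Set E) (p : E) : Set E :=
  {w | ∃ γ : ℝ → E, IsCurveThrough M p γ ∧ deriv γ 0 = w}

/-- `v` is the Riemannian gradient at `p` of the restriction of `f` to `M`, where `M` carries the
metric induced by the ambient space: `v` is tangent to `M` at `p`, and the derivative of `f`
along any curve in `M` through `p` is the inner product of `v` with the velocity. -/
structure IsRiemannianGradient {E : Type*} [NormedAddCommGroup E] [InnerProductSpace ℝ E]
    (f : E → ℝ) (M : Set E) (p v : E) : Prop where
  tangent : v ∈ tangentVectors M p
  hasDerivAt : ∀ γ : ℝ → E, IsCurveThrough M p γ →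
    HasDerivAt (fun t => f (γ t)) (inner ℝ v (deriv γ 0)) 0

/-!
Near `xbar`, a gradient of `f` at a point of differentiability is the gradient of any active
function, and affine independence makes every active function the strict maximum along some
direction. So the Goldstein subdifferential is the convex hull of the gradients `∇ F i y` at the
points `y` of the ball at which `F i` is active (`HasUniformBounds.goldsteinSubdifferential_eq`).

Since zero lies in the relative interior of the simplex spanned by the gradients at `xbar`, it is a
combination of them with positive weights. By affine independence a short Goldstein subgradient is
`g = ∑ i, w i • G i` with weights close to those, hence positive, where `G i` is in the hull of
gradients of `F i` (`HasUniformBounds.exists_pos_weights`). This has two consequences.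

* Each function is active somewhere in the ball of radius `ε` around `x`, so that the values `F i x`
  differ by `O(ε)`. If `p` is a nearest point to `x` in the active manifold, then `x - p` is normal
  to it, that is, `x - p = ∑ i, c i • ∇ F i p` with `∑ i, c i = 0` and `c = O(‖x - p‖)`. Expanding
  `‖x - p‖ ^ 2` along this combination gives `‖x - p‖ = O(ε)`
  (`HasUniformBounds.norm_sub_le_of_isNearestPoint`). The same expansion, applied to two nearest
  points, shows that they coincide.

* As the weights can be perturbed in both directions, minimality makes `g` orthogonal to all
  differences `G i - G j`, which are `O(ε)`-close to the differences `∇ F i p - ∇ F j p` spanning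
  the normal space at `p`. So the normal component of `g` is `O(ε)`. Its tangential component is a
  convex combination of projections of the `G i`, each `O(ε)`-close to the projection of `∇ F i p`,
  which for every `i` is the Riemannian gradient (`norm_sub_starProjection_le`).
-/

/-! ### Affinely independent vectors -/

/-- Weights of sum zero are controlled by the combination of affinely independent vectors that they
define: this is injectivity of a linear map in finite dimension, made quantitative. -/
theorem AffineIndependent.exists_sum_abs_le {E : Type*} [NormedAddCommGroup E]
    [InnerProductSpace ℝ E] {ι : Type*} [Fintype ι] {a : ι → E} (ha : AffineIndependent ℝ a) :
    ∃ C : ℝ, 0 < C ∧ ∀ c : ι → ℝ, ∑ i, c i = 0 → ∑ i, |c i| ≤ C * ‖∑ i, c i • a i‖ := by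
  let A : (ι → ℝ) →ₗ[ℝ] ℝ × E :=
    (Fintype.linearCombination ℝ (fun _ : ι => (1 : ℝ))).prod (Fintype.linearCombination ℝ a)
  have hA : LinearMap.ker A = ⊥ := by
    rw [LinearMap.ker_eq_bot']
    intro c hc
    have h1 : ∑ i, c i = 0 := by
      simpa [A, Fintype.linearCombination_apply] using congrArg Prod.fst hc
    have h2 : ∑ i, c i • a i = 0 := by
      simpa [A, Fintype.linearCombination_apply] using congrArg Prod.snd hc
    funext i
    exact affineIndependent_iff.1 ha Finset.univ c h1 h2 i (Finset.mem_univ i)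
  obtain ⟨K, hK, hanti⟩ := A.exists_antilipschitzWith hA
  refine ⟨(Fintype.card ι + 1) * K, by positivity, fun c hc => ?_⟩
  have h1 : ‖c‖ ≤ K * ‖∑ i, c i • a i‖ := by
    have h := hanti.le_mul_dist c 0
    rw [map_zero, dist_zero_right, dist_zero_right] at h
    have h2 : A c = (0, ∑ i, c i • a i) := by
      simp [A, Fintype.linearCombination_apply, hc]
    rw [h2, Prod.norm_def] at h
    simpa using h
  have h3 : ∑ i, |c i| ≤ Fintype.card ι * ‖c‖ := by
    refine (Finset.sum_le_sum fun i _ => (norm_le_pi_norm c i)).trans ?_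
    simp
  nlinarith [norm_nonneg c]

/-- The quantitative form of affine independence is stable under small perturbations of the
vectors. -/
theorem sum_abs_le_of_norm_sub_le {E : Type*} [NormedAddCommGroup E] [InnerProductSpace ℝ E]
    {ι : Type*} [Fintype ι] {a b : ι → E} {C : ℝ} (hC : 0 < C)
    (ha : ∀ c : ι → ℝ, ∑ i, c i = 0 → ∑ i, |c i| ≤ C * ‖∑ i, c i • a i‖)
    (hab : ∀ i, ‖a i - b i‖ ≤ 1 / (2 * C)) (c : ι → ℝ) (hc : ∑ i, c i = 0) :
    ∑ i, |c i| ≤ 2 * C * ‖∑ i, c i • b i‖ := by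
  have h1 : ‖∑ i, c i • (a i - b i)‖ ≤ (∑ i, |c i|) * (1 / (2 * C)) := by
    rw [Finset.sum_mul]
    refine (norm_sum_le _ _).trans (Finset.sum_le_sum fun i _ => ?_)
    rw [norm_smul, Real.norm_eq_abs]
    exact mul_le_mul_of_nonneg_left (hab i) (abs_nonneg _)
  have h2 : ∑ i, c i • a i = ∑ i, c i • (a i - b i) + ∑ i, c i • b i := by
    rw [← Finset.sum_add_distrib]
    simp [smul_sub]
  have h3 := ha c hc
  rw [h2] at h3
  have h4 := mul_le_mul_of_nonneg_left
    ((norm_add_le (∑ i, c i • (a i - b i)) (∑ i, c i • b i)).trans (add_le_add_left h1 _)) hC.le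
  have h5 : C * ((∑ i, |c i|) * (1 / (2 * C)) + ‖∑ i, c i • b i‖)
      = (∑ i, |c i|) / 2 + C * ‖∑ i, c i • b i‖ := by
    field_simp
  linarith

theorem affineIndependent_of_sum_abs_le {E : Type*} [NormedAddCommGroup E] [InnerProductSpace ℝ E]
    {ι : Type*} [Fintype ι] {a : ι → E} {C : ℝ}
    (ha : ∀ c : ι → ℝ, ∑ i, c i = 0 → ∑ i, |c i| ≤ C * ‖∑ i, c i • a i‖) :
    AffineIndependent ℝ a := by
  rw [affineIndependent_iff_of_fintype]
  intro w hw hw' i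
  rw [Finset.weightedVSub_eq_linear_combination _ hw] at hw'
  have h := ha w hw
  rw [hw', norm_zero, mul_zero] at h
  have h2 := Finset.single_le_sum (f := fun j => |w j|) (fun j _ => abs_nonneg _)
    (Finset.mem_univ i)
  exact abs_nonpos_iff.1 (h2.trans h)

/-- An affine function takes arbitrary values at affinely independent points; `d` is its slope. -/
theorem AffineIndependent.exists_inner_sub_inner_eq {E : Type*} [NormedAddCommGroup E]
    [InnerProductSpace ℝ E] [FiniteDimensional ℝ E] {ι : Type*} [Fintype ι] {a : ι → E}
    (ha : AffineIndependent ℝ a) (c : ι → ℝ) :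
    ∃ d : E, ∀ i j, inner ℝ (a i) d - inner ℝ (a j) d = c i - c j := by
  classical
  let B : E × ℝ →ₗ[ℝ] (ι → ℝ) := LinearMap.pi fun i =>
    ((innerSL ℝ (a i)).toLinearMap.comp (LinearMap.fst ℝ E ℝ)) + LinearMap.snd ℝ E ℝ
  have hB : LinearMap.range B = ⊤ := by
    by_contra hne
    obtain ⟨φ, hφ, hker⟩ := Submodule.exists_le_ker_of_lt_top _ (lt_top_iff_ne_top.2 hne)
    have hval : ∀ e : ι → ℝ, φ e = ∑ i, φ (Pi.single i 1) * e i := by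
      intro e
      conv_lhs => rw [pi_eq_sum_univ' e]
      rw [map_sum]
      refine Finset.sum_congr rfl fun i _ => ?_
      rw [map_smul, smul_eq_mul, mul_comm]
    have h0 : ∀ (d : E) (s : ℝ), ∑ i, φ (Pi.single i 1) * (inner ℝ (a i) d + s) = 0 := by
      intro d s
      have := hker (LinearMap.mem_range_self B (d, s))
      rw [LinearMap.mem_ker, hval] at this
      simpa [B] using this
    have h1 : ∑ i, φ (Pi.single i 1) = 0 := by simpa using h0 0 1
    have h2 : ∑ i, φ (Pi.single i 1) • a i = 0 := by
      rw [← inner_self_eq_zero (𝕜 := ℝ), sum_inner]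
      simpa [inner_smul_left] using h0 (∑ i, φ (Pi.single i 1) • a i) 0
    have h3 := affineIndependent_iff.1 ha Finset.univ (fun i => φ (Pi.single i 1)) h1 h2
    apply hφ
    ext e
    simpa using h3 e (Finset.mem_univ e)
  obtain ⟨⟨d, s⟩, hds⟩ := LinearMap.range_eq_top.1 hB c
  refine ⟨d, fun i j => ?_⟩
  rw [← hds]
  simp [B]

theorem mem_vectorSpan_range_iff_exists_sum {E : Type*} [NormedAddCommGroup E]
    [InnerProductSpace ℝ E] {ι : Type*} [Fintype ι] {a : ι → E} {v : E} :
    v ∈ vectorSpan ℝ (range a) ↔ ∃ c : ι → ℝ, ∑ i, c i = 0 ∧ ∑ i, c i • a i = v := by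
  classical
  rw [mem_vectorSpan_iff_eq_weightedVSub]
  constructor
  · rintro ⟨s, w, hw, rfl⟩
    refine ⟨fun i => if i ∈ s then w i else 0, by simpa using hw, ?_⟩
    rw [Finset.weightedVSub_eq_linear_combination _ hw]
    simp [ite_smul]
  · rintro ⟨c, hc, rfl⟩
    exact ⟨Finset.univ, c, hc, (Finset.weightedVSub_eq_linear_combination _ hc).symm⟩

theorem mem_orthogonal_vectorSpan_range_iff {E : Type*} [NormedAddCommGroup E]
    [InnerProductSpace ℝ E] {ι : Type*} {a : ι → E} {w : E} :
    w ∈ (vectorSpan ℝ (range a))ᗮ ↔ ∀ i j, inner ℝ (a i) w = inner ℝ (a j) w := by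
  constructor
  · intro h i j
    have := h _ (vsub_mem_vectorSpan ℝ (mem_range_self i) (mem_range_self j))
    rwa [vsub_eq_sub, inner_sub_left, sub_eq_zero] at this
  · intro h
    have hle : vectorSpan ℝ (range a) ≤ (ℝ ∙ w)ᗮ := by
      rw [vectorSpan_def, Submodule.span_le]
      rintro _ ⟨_, ⟨i, rfl⟩, _, ⟨j, rfl⟩, rfl⟩
      rw [SetLike.mem_coe, Submodule.mem_orthogonal_singleton_iff_inner_left]
      simp only [vsub_eq_sub]
      rw [inner_sub_left, h i j, sub_self]
    intro u hu
    exact (Submodule.mem_orthogonal_singleton_iff_inner_left).1 (hle hu)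

/-! ### Convex hulls -/

/-- In finite dimension Carathéodory's theorem bounds the number of points in a convex combination,
so the convex hull is a finite union of continuous images of compact sets. -/
theorem IsCompact.convexHull_of_finiteDimensional {E : Type*} [NormedAddCommGroup E]
    [NormedSpace ℝ E] [FiniteDimensional ℝ E] {s : Set E} (hs : IsCompact s) :
    IsCompact (convexHull ℝ s) := by
  have h : convexHull ℝ s = ⋃ n ∈ Finset.range (Module.finrank ℝ E + 2),
      (fun q : (Fin n → ℝ) × (Fin n → E) => ∑ k, q.1 k • q.2 k) ''
        (stdSimplex ℝ (Fin n) ×ˢ Set.univ.pi fun _ => s) := by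
    apply Subset.antisymm
    · intro x hx
      obtain ⟨κ, _, z, w, hz, hind, hw, hw1, rfl⟩ := eq_pos_convex_span_of_mem_convexHull hx
      have hcard := hind.card_le_finrank_succ
      have hcard' : Fintype.card κ ≤ Module.finrank ℝ E + 1 :=
        hcard.trans (Nat.succ_le_succ (Submodule.finrank_le _))
      let e := (Fintype.equivFin κ).symm
      refine mem_biUnion (x := Fintype.card κ) (by simpa using by omega)
        ⟨(w ∘ e, z ∘ e), ⟨⟨fun k => (hw _).le, ?_⟩, fun k _ => hz (mem_range_self _)⟩, ?_⟩
      · rw [← hw1]; exact e.sum_comp w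
      · exact e.sum_comp fun k => w k • z k
    · refine iUnion₂_subset fun n _ => ?_
      rintro _ ⟨⟨w, z⟩, ⟨⟨hw0, hw1⟩, hz⟩, rfl⟩
      exact mem_convexHull_of_exists_fintype w z hw0 hw1 (fun k => hz k (mem_univ k)) rfl
  rw [h]
  refine Finset.isCompact_biUnion _ fun n _ => ?_
  refine ((isCompact_stdSimplex ℝ (Fin n)).prod (isCompact_univ_pi fun _ => hs)).image ?_
  fun_prop

/-- A point of the convex hull of a finite union is a convex combination of points of the convex
hulls. The point chosen in a hull is meaningful only where its weight is positive, since some of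
the sets may be empty. -/
theorem exists_weights_of_mem_convexHull_iUnion {E : Type*} [NormedAddCommGroup E]
    [NormedSpace ℝ E] {ι : Type*} [Fintype ι] {S : ι → Set E} {g : E}
    (hg : g ∈ convexHull ℝ (⋃ i, S i)) :
    ∃ (w : ι → ℝ) (G : ι → E), (∀ i, 0 ≤ w i) ∧ ∑ i, w i = 1 ∧
      (∀ i, 0 < w i → G i ∈ convexHull ℝ (S i)) ∧ ∑ i, w i • G i = g := by
  classical
  obtain ⟨κ, _, v, z, hv0, hv1, hz, rfl⟩ := mem_convexHull_iff_exists_fintype.1 hg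
  choose σ hσ using fun k => mem_iUnion.1 (hz k)
  refine ⟨fun i => ∑ k with σ k = i, v k,
    fun i => (Finset.univ.filter fun k => σ k = i).centerMass v z,
    fun i => Finset.sum_nonneg fun k _ => hv0 k, ?_, fun i hi => ?_, ?_⟩
  · rw [← hv1]
    exact Finset.sum_fiberwise _ _ _
  · refine Finset.centerMass_mem_convexHull _ (fun k _ => hv0 k) hi fun k hk => ?_
    have := hσ k
    rwa [(Finset.mem_filter.1 hk).2] at this
  · rw [← Finset.sum_fiberwise (s := Finset.univ) (g := σ) (f := fun k => v k • z k)]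
    refine Finset.sum_congr rfl fun i _ => ?_
    beta_reduce
    rcases (Finset.sum_nonneg fun k (_ : k ∈ Finset.univ.filter fun k => σ k = i) =>
      hv0 k).eq_or_lt with h | h
    · rw [← h, zero_smul, eq_comm]
      refine Finset.sum_eq_zero fun k hk => ?_
      rw [(Finset.sum_eq_zero_iff_of_nonneg fun k _ => hv0 k).1 h.symm k hk, zero_smul]
    · unfold Finset.centerMass
      rw [smul_inv_smul₀ h.ne']

theorem exists_weights_of_mem_convexHull_range {E : Type*} [NormedAddCommGroup E]
    [NormedSpace ℝ E] {ι : Type*} [Fintype ι] {a : ι → E} {g : E}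
    (hg : g ∈ convexHull ℝ (range a)) :
    ∃ w : ι → ℝ, (∀ i, 0 ≤ w i) ∧ ∑ i, w i = 1 ∧ ∑ i, w i • a i = g := by
  rw [convexHull_range_eq_exists_affineCombination] at hg
  classical
  obtain ⟨s, w, hw0, hw1, rfl⟩ := hg
  refine ⟨fun i => if i ∈ s then w i else 0, fun i => ?_, by simpa using hw1, ?_⟩
  · beta_reduce
    split_ifs with h
    exacts [hw0 i h, le_rfl]
  · rw [Finset.affineCombination_eq_linear_combination _ _ _ hw1]
    simp [ite_smul]

/-- A relative interior point of a polytope is a combination of all the vertices with positive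
weights: a segment from the barycentre to the point can be prolonged inside the polytope. -/
theorem exists_pos_weights_of_zero_mem_intrinsicInterior {E : Type*} [NormedAddCommGroup E]
    [NormedSpace ℝ E] {ι : Type*} [Fintype ι] [Nonempty ι] {a : ι → E}
    (h : (0 : E) ∈ intrinsicInterior ℝ (convexHull ℝ (range a))) :
    ∃ l : ι → ℝ, (∀ i, 0 < l i) ∧ ∑ i, l i = 1 ∧ ∑ i, l i • a i = 0 := by
  set P := convexHull ℝ (range a) with hP
  obtain ⟨y, hy, hy0⟩ := mem_intrinsicInterior.1 h
  set n : ℝ := (Fintype.card ι : ℝ) with hn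
  have hnpos : 0 < n := by simp only [hn]; exact_mod_cast Fintype.card_pos
  set b : E := ∑ i, n⁻¹ • a i with hb
  have hbP : b ∈ P := by
    refine mem_convexHull_of_exists_fintype (fun _ => n⁻¹) a (fun _ => by positivity) ?_
      (fun i => mem_range_self i) rfl
    simp [← hn, hnpos.ne']
  have h0 : (0 : E) ∈ affineSpan ℝ P := hy0 ▸ y.2
  have hmem : ∀ t : ℝ, -(t • b) ∈ affineSpan ℝ P := by
    intro t
    have := AffineMap.lineMap_mem (-t) h0 (subset_affineSpan ℝ P hbP)
    simpa [AffineMap.lineMap_apply] using this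
  let c : ℝ → affineSpan ℝ P := fun t => ⟨-(t • b), hmem t⟩
  have hc : Continuous c := by
    apply Continuous.subtype_mk
    fun_prop
  have hc0 : c 0 = y := by
    apply Subtype.ext
    simp [c, hy0]
  have hev : ∀ᶠ t in 𝓝 (0 : ℝ), c t ∈ ((↑) ⁻¹' P : Set (affineSpan ℝ P)) := by
    apply hc.continuousAt.eventually_mem
    rw [hc0]
    exact mem_interior_iff_mem_nhds.1 hy
  obtain ⟨r, hr, hball⟩ := Metric.eventually_nhds_iff.1 hev
  have ht : -((r / 2) • b) ∈ P := hball (y := r / 2) (by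
    rw [Real.dist_eq, sub_zero, abs_of_pos (by positivity)]; linarith)
  obtain ⟨w, hw0, hw1, hw⟩ := exists_weights_of_mem_convexHull_range ht
  have hs : 0 < 1 + r / 2 := by positivity
  refine ⟨fun i => (1 + r / 2)⁻¹ * (w i + r / 2 * n⁻¹), fun i => ?_, ?_, ?_⟩
  · have := hw0 i
    positivity
  · rw [← Finset.mul_sum, Finset.sum_add_distrib, hw1]
    simp only [Finset.sum_const, Finset.card_univ, nsmul_eq_mul, ← hn]
    field_simp
  · simp_rw [mul_smul, ← Finset.smul_sum, add_smul, Finset.sum_add_distrib, hw, mul_smul,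
      ← Finset.smul_sum, hb, ← Finset.smul_sum]
    rw [neg_add_cancel, smul_zero]

/-! ### First-order estimates for smooth functions -/

theorem ContDiff.hasGradientAt_gradient {E : Type*} [NormedAddCommGroup E] [InnerProductSpace ℝ E]
    [CompleteSpace E] {h : E → ℝ} (hh : ContDiff ℝ 2 h) (y : E) :
    HasGradientAt h (gradient h y) y :=
  ((hh.differentiable (by norm_num)) y).hasGradientAt

theorem ContDiff.contDiff_gradient {E : Type*} [NormedAddCommGroup E] [InnerProductSpace ℝ E]
    [CompleteSpace E] {h : E → ℝ} (hh : ContDiff ℝ 2 h) : ContDiff ℝ 1 (gradient h) := by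
  have h1 : ContDiff ℝ 1 (fderiv ℝ h) := hh.fderiv_right (by norm_num)
  exact (InnerProductSpace.toDual ℝ E).symm.contDiff.comp h1

/-- On a ball, finitely many `C²` functions and their gradients are Lipschitz, and the error of the
first-order expansion is quadratic, all with one constant. -/
theorem exists_lipschitz_and_taylor_bound {E : Type*} [NormedAddCommGroup E]
    [InnerProductSpace ℝ E] [FiniteDimensional ℝ E] [CompleteSpace E] {ι : Type*} [Fintype ι]
    {F : ι → E → ℝ} (hF : ∀ i, ContDiff ℝ 2 (F i)) (x₀ : E) (r : ℝ) :
    ∃ L : ℝ, 0 < L ∧ ∀ i, ∀ y ∈ Metric.closedBall x₀ r, ∀ z ∈ Metric.closedBall x₀ r,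
      |F i y - F i z| ≤ L * ‖y - z‖ ∧ ‖gradient (F i) y - gradient (F i) z‖ ≤ L * ‖y - z‖ ∧
      |F i z - F i y - inner ℝ (gradient (F i) y) (z - y)| ≤ L * ‖z - y‖ ^ 2 := by
  have hconv := convex_closedBall x₀ r
  have hcomp : IsCompact (Metric.closedBall x₀ r) := isCompact_closedBall x₀ r
  choose A hA using fun i => (hF i).contDiffOn.exists_lipschitzOnWith two_ne_zero hconv hcomp
  choose B hB using fun i =>
    (hF i).contDiff_gradient.contDiffOn.exists_lipschitzOnWith one_ne_zero hconv hcomp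
  have hle : ∀ i, (A i : ℝ) ≤ 1 + ∑ j, ((A j : ℝ) + B j) ∧
      (B i : ℝ) ≤ 1 + ∑ j, ((A j : ℝ) + B j) := by
    intro i
    have := Finset.single_le_sum (f := fun j => (A j : ℝ) + B j) (fun j _ => by positivity)
      (Finset.mem_univ i)
    have h1 := (A i).coe_nonneg
    have h2 := (B i).coe_nonneg
    constructor <;> linarith
  refine ⟨1 + ∑ j, ((A j : ℝ) + B j), by positivity, fun i y hy z hz => ⟨?_, ?_, ?_⟩⟩
  · have := (hA i).dist_le_mul y hy z hz
    rw [Real.dist_eq, dist_eq_norm] at this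
    exact this.trans (mul_le_mul_of_nonneg_right (hle i).1 (norm_nonneg _))
  · have := (hB i).dist_le_mul y hy z hz
    rw [dist_eq_norm, dist_eq_norm] at this
    exact this.trans (mul_le_mul_of_nonneg_right (hle i).2 (norm_nonneg _))
  · -- the mean value inequality on the segment, where the gradient differs from the one at `y`
    -- by at most a multiple of the length
    have hseg : segment ℝ y z ⊆ Metric.closedBall x₀ r := hconv.segment_subset hy hz
    have hbound : ∀ u ∈ segment ℝ y z, ‖InnerProductSpace.toDual ℝ E (gradient (F i) u)
        - InnerProductSpace.toDual ℝ E (gradient (F i) y)‖ ≤ B i * ‖z - y‖ := by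
      intro u hu
      rw [← map_sub, LinearIsometryEquiv.norm_map]
      have := (hB i).dist_le_mul u (hseg hu) y hy
      rw [dist_eq_norm, dist_eq_norm] at this
      refine this.trans (mul_le_mul_of_nonneg_left ?_ (B i).coe_nonneg)
      exact norm_sub_le_of_mem_segment hu
    have := Convex.norm_image_sub_le_of_norm_hasFDerivWithin_le' (𝕜 := ℝ)
      (fun u _ => ((hF i).hasGradientAt_gradient u).hasFDerivAt.hasFDerivWithinAt)
      hbound (convex_segment y z) (left_mem_segment ℝ y z) (right_mem_segment ℝ y z)
    rw [InnerProductSpace.toDual_apply_apply, Real.norm_eq_abs] at this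
    refine this.trans ?_
    rw [mul_assoc, ← sq]
    exact mul_le_mul_of_nonneg_right (hle i).2 (sq_nonneg _)

/-! ### The active manifold: tangent vectors and Riemannian gradients -/

theorem IsCurveThrough.hasDerivAt {E : Type*} [NormedAddCommGroup E] [NormedSpace ℝ E]
    {M : Set E} {p : E} {γ : ℝ → E} (hγ : IsCurveThrough M p γ) :
    HasDerivAt γ (deriv γ 0) 0 :=
  (hγ.contDiffAt.differentiableAt one_ne_zero).hasDerivAt

theorem IsCurveThrough.hasDerivAt_comp {E : Type*} [NormedAddCommGroup E] [InnerProductSpace ℝ E]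
    [CompleteSpace E] {M : Set E} {p u : E} {γ : ℝ → E} (hγ : IsCurveThrough M p γ) {h : E → ℝ}
    (hh : HasGradientAt h u p) :
    HasDerivAt (fun t => h (γ t)) (inner ℝ u (deriv γ 0)) 0 := by
  rw [← hγ.map_zero] at hh
  have := hh.hasFDerivAt.comp_hasDerivAt (0 : ℝ) hγ.hasDerivAt
  rwa [InnerProductSpace.toDual_apply_apply] at this

/-- Where the gradients are affinely independent, the tangent space of the active manifold is the
space of vectors having the same inner product with all of them.

For the nontrivial inclusion, let `e i` be dual to the gradients `a i`. The map
`Φ z = z + ∑ i, (F i z - F i p - ⟪a i, z - p⟫) • e i` has the identity as its derivative at `p`, and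
`⟪a j - a k, Φ z - p⟫ = F j z - F k z`. So its local inverse carries the line `p + t w` into the
active manifold. -/
theorem mem_tangentVectors_activeManifold_iff {E : Type*} [NormedAddCommGroup E]
    [InnerProductSpace ℝ E] [FiniteDimensional ℝ E] [CompleteSpace E] {ι : Type*} [Fintype ι]
    {F : ι → E → ℝ} (hF : ∀ i, ContDiff ℝ 2 (F i)) {p : E} (hp : p ∈ activeManifold F)
    (hind : AffineIndependent ℝ fun i => gradient (F i) p) {w : E} :
    w ∈ tangentVectors (activeManifold F) p ↔
      w ∈ (vectorSpan ℝ (range fun i => gradient (F i) p))ᗮ := by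
  rw [mem_orthogonal_vectorSpan_range_iff]
  constructor
  · rintro ⟨γ, hγ, rfl⟩ i j
    have hi := hγ.hasDerivAt_comp ((hF i).hasGradientAt_gradient p)
    have hj := hγ.hasDerivAt_comp ((hF j).hasGradientAt_gradient p)
    refine hi.unique (hj.congr_of_eventuallyEq ?_)
    filter_upwards [hγ.mem] with t ht using ht i j
  · intro hw
    classical
    choose e he using fun i => hind.exists_inner_sub_inner_eq (Pi.single i (1 : ℝ))
    set a := fun i => gradient (F i) p with ha
    let Φ : E → E := fun z => z + ∑ i, (F i z - F i p - inner ℝ (a i) (z - p)) • e i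
    have hΦp : Φ p = p := by simp [Φ]
    have hΦ : ContDiff ℝ 2 Φ :=
      contDiff_id.add (ContDiff.sum fun i _ => (((hF i).sub contDiff_const).sub
        (contDiff_const.inner ℝ (contDiff_id.sub contDiff_const))).smul contDiff_const)
    have hΦ' : HasFDerivAt Φ ((ContinuousLinearEquiv.refl ℝ E : E ≃L[ℝ] E) : E →L[ℝ] E) p := by
      have h1 : ∀ i, HasFDerivAt (fun z => F i z - F i p - inner ℝ (a i) (z - p))
          (0 : E →L[ℝ] ℝ) p := by
        intro i
        have h2 := ((hF i).hasGradientAt_gradient p).hasFDerivAt.sub_const (F i p)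
        have h3 : HasFDerivAt (fun z => inner ℝ (a i) (z - p))
            (InnerProductSpace.toDual ℝ E (a i)) p :=
          (InnerProductSpace.toDual ℝ E (a i)).hasFDerivAt.comp p
            ((hasFDerivAt_id p).sub_const p)
        have h4 := h2.sub h3
        rwa [sub_self] at h4
      have h5 := (hasFDerivAt_id (𝕜 := ℝ) p).add
        (HasFDerivAt.fun_sum (u := Finset.univ) fun i _ => (h1 i).smul_const (e i))
      convert! h5 using 1
      ext v
      simp
    have hinner : ∀ z j k, inner ℝ (a j) (Φ z - p) - inner ℝ (a k) (Φ z - p) = F j z - F k z := by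
      intro z j k
      have h1 : ∀ l, inner ℝ (a l) (Φ z - p) = inner ℝ (a l) (z - p)
          + ∑ i, (F i z - F i p - inner ℝ (a i) (z - p)) * inner ℝ (a l) (e i) := by
        intro l
        simp only [Φ, add_sub_right_comm, inner_add_right, inner_sum, inner_smul_right]
      have h2 : ∑ i, (F i z - F i p - inner ℝ (a i) (z - p)) * inner ℝ (a j) (e i)
          - ∑ i, (F i z - F i p - inner ℝ (a i) (z - p)) * inner ℝ (a k) (e i)
          = (F j z - F j p - inner ℝ (a j) (z - p)) - (F k z - F k p - inner ℝ (a k) (z - p)) := by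
        rw [← Finset.sum_sub_distrib]
        simp_rw [← mul_sub]
        simp only [ha] at he ⊢
        simp_rw [he, mul_sub, Finset.sum_sub_distrib, Pi.single_apply]
        simp
      rw [h1, h1]
      have := hp j k
      linarith
    have hcd : ContDiffAt ℝ 2 Φ p := hΦ.contDiffAt
    let Ψ := hcd.localInverse hΦ' two_ne_zero
    have hΨp : Ψ p = p := by
      have := hcd.localInverse_apply_image hΦ' two_ne_zero
      rwa [hΦp] at this
    have hΨ : ContDiffAt ℝ 2 Ψ p := by
      have := hcd.to_localInverse hΦ' two_ne_zero
      rwa [hΦp] at this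
    have hright : ∀ᶠ y in 𝓝 p, Φ (Ψ y) = y := by
      have := (hcd.hasStrictFDerivAt' hΦ' two_ne_zero).eventually_right_inverse
      rwa [hΦp] at this
    have hΨ' : HasFDerivAt Ψ (ContinuousLinearMap.id ℝ E) p := by
      have := (hcd.hasStrictFDerivAt' hΦ' two_ne_zero).to_localInverse.hasFDerivAt
      rwa [hΦp] at this
    have hline : HasDerivAt (fun t : ℝ => p + t • w) w 0 := by
      simpa using ((hasDerivAt_id (0 : ℝ)).smul_const w).const_add p
    have htend : Tendsto (fun t : ℝ => p + t • w) (𝓝 0) (𝓝 p) := by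
      simpa using hline.continuousAt.tendsto
    refine ⟨fun t => Ψ (p + t • w), ⟨?_, by simp [hΨp], ?_⟩, ?_⟩
    · have h1 : ContDiffAt ℝ 1 Ψ (p + (0 : ℝ) • w) := by
        rw [zero_smul, add_zero]
        exact hΨ.of_le (by norm_num)
      exact h1.comp (0 : ℝ) (by fun_prop)
    · filter_upwards [htend.eventually hright] with t ht i j
      have := hinner (Ψ (p + t • w)) i j
      rw [ht, add_sub_cancel_left, inner_smul_right, inner_smul_right, hw i j] at this
      linarith
    · have h1 : HasFDerivAt Ψ (ContinuousLinearMap.id ℝ E) (p + (0 : ℝ) • w) := by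
        rwa [zero_smul, add_zero]
      exact (h1.comp_hasDerivAt (0 : ℝ) hline).deriv

/-- The Riemannian gradient is the common projection onto the tangent space of the gradients of the
functions, since each of them has the same restriction to the active manifold as their maximum. -/
theorem isRiemannianGradient_activeManifold_iff {E : Type*} [NormedAddCommGroup E]
    [InnerProductSpace ℝ E] [FiniteDimensional ℝ E] [CompleteSpace E] {ι : Type*} [Fintype ι]
    {f : E → ℝ} {F : ι → E → ℝ} (hF : ∀ i, ContDiff ℝ 2 (F i)) {p : E}
    (hp : p ∈ activeManifold F) (hind : AffineIndependent ℝ fun i => gradient (F i) p)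
    (hmax : ∀ᶠ x in 𝓝 p, IsGreatest (range fun i => F i x) (f x)) (i : ι) {v : E} :
    IsRiemannianGradient f (activeManifold F) p v ↔
      v = (vectorSpan ℝ (range fun i => gradient (F i) p))ᗮ.starProjection (gradient (F i) p) := by
  set T := (vectorSpan ℝ (range fun i => gradient (F i) p))ᗮ with hT
  have hderiv : ∀ γ : ℝ → E, IsCurveThrough (activeManifold F) p γ →
      HasDerivAt (fun t => f (γ t))
        (inner ℝ (T.starProjection (gradient (F i) p)) (deriv γ 0)) 0 := by
    intro γ hγ
    have hmem : deriv γ 0 ∈ T :=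
      (mem_tangentVectors_activeManifold_iff hF hp hind).1 ⟨γ, hγ, rfl⟩
    have hi := hγ.hasDerivAt_comp ((hF i).hasGradientAt_gradient p)
    rw [Submodule.inner_starProjection_left_eq_right,
      Submodule.starProjection_eq_self_iff.2 hmem]
    refine hi.congr_of_eventuallyEq ?_
    have htend : Tendsto γ (𝓝 0) (𝓝 p) := by
      simpa [hγ.map_zero] using hγ.hasDerivAt.continuousAt.tendsto
    filter_upwards [hγ.mem, htend.eventually hmax] with t ht htm
    obtain ⟨j, hj⟩ := htm.1
    rw [← hj]
    exact ht j i
  constructor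
  · intro hv
    have hvT := (mem_tangentVectors_activeManifold_iff hF hp hind).1 hv.tangent
    have hd : v - T.starProjection (gradient (F i) p) ∈ T :=
      T.sub_mem hvT (T.starProjection_apply_mem _)
    obtain ⟨γ, hγ, hγd⟩ := (mem_tangentVectors_activeManifold_iff hF hp hind).2 hd
    have h1 := (hv.hasDerivAt γ hγ).unique (hderiv γ hγ)
    rw [← sub_eq_zero, ← inner_sub_left, hγd, inner_self_eq_zero, sub_eq_zero] at h1
    exact h1
  · rintro rfl
    exact ⟨(mem_tangentVectors_activeManifold_iff hF hp hind).2 (T.starProjection_apply_mem _),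
      hderiv⟩

/-! ### Nearest points of the active manifold -/

/-- The Lagrange condition: the displacement from a nearest point is normal to the active
manifold. -/
theorem IsNearestPoint.sub_mem_vectorSpan {E : Type*} [NormedAddCommGroup E]
    [InnerProductSpace ℝ E] [FiniteDimensional ℝ E] [CompleteSpace E] {ι : Type*} [Fintype ι]
    {F : ι → E → ℝ} (hF : ∀ i, ContDiff ℝ 2 (F i)) {x p : E}
    (hp : IsNearestPoint (activeManifold F) x p)
    (hind : AffineIndependent ℝ fun i => gradient (F i) p) :
    x - p ∈ vectorSpan ℝ (range fun i => gradient (F i) p) := by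
  rw [← Submodule.orthogonal_orthogonal (vectorSpan ℝ (range fun i => gradient (F i) p)),
    Submodule.mem_orthogonal]
  intro w hw
  obtain ⟨γ, hγ, rfl⟩ := (mem_tangentVectors_activeManifold_iff hF hp.1 hind).2 hw
  have h1 := (hγ.hasDerivAt.const_sub x).norm_sq
  have hmin : IsLocalMin (fun t => ‖x - γ t‖ ^ 2) 0 := by
    filter_upwards [hγ.mem] with t ht
    rw [hγ.map_zero]
    exact pow_le_pow_left₀ (norm_nonneg _) (hp.2 _ ht) 2
  have h2 := hmin.hasDerivAt_eq_zero h1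
  rw [hγ.map_zero, inner_neg_right, real_inner_comm] at h2
  linarith

theorem exists_isNearestPoint_activeManifold {E : Type*} [NormedAddCommGroup E]
    [InnerProductSpace ℝ E] [FiniteDimensional ℝ E] {ι : Type*}
    {F : ι → E → ℝ} (hF : ∀ i, Continuous (F i)) (hne : (activeManifold F).Nonempty) (x : E) :
    ∃ p, IsNearestPoint (activeManifold F) x p := by
  have hcl : IsClosed (activeManifold F) := by
    simp only [activeManifold, ofPred_forall]
    exact isClosed_iInter fun i => isClosed_iInter fun j => isClosed_eq (hF i) (hF j)
  obtain ⟨p, hp, hpd⟩ := hcl.exists_infDist_eq_dist hne x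
  refine ⟨p, hp, fun q hq => ?_⟩
  rw [← dist_eq_norm, ← dist_eq_norm, ← hpd]
  exact Metric.infDist_le_dist_of_mem hq

/-! ### Uniform estimates near the minimizer -/

/-- Estimates for the family `F` on the closed ball of radius `r` around `x₀`, on which `f` is its
maximum: a common constant `L` for the Lipschitz and first-order expansion bounds, and a constant
`C` for the quantitative affine independence of the gradients. -/
structure HasUniformBounds {E : Type*} [NormedAddCommGroup E] [InnerProductSpace ℝ E]
    [CompleteSpace E] {ι : Type*} [Fintype ι] (f : E → ℝ) (F : ι → E → ℝ) (x₀ : E)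
    (r L C : ℝ) : Prop where
  smooth : ∀ i, ContDiff ℝ 2 (F i)
  lipschitz_pos : 0 < L
  coeff_pos : 0 < C
  eventually_isGreatest : ∀ y ∈ Metric.closedBall x₀ r,
    ∀ᶠ z in 𝓝 y, IsGreatest (range fun i => F i z) (f z)
  lipschitz : ∀ i, ∀ y ∈ Metric.closedBall x₀ r, ∀ z ∈ Metric.closedBall x₀ r,
    |F i y - F i z| ≤ L * ‖y - z‖
  lipschitz_gradient : ∀ i, ∀ y ∈ Metric.closedBall x₀ r, ∀ z ∈ Metric.closedBall x₀ r,
    ‖gradient (F i) y - gradient (F i) z‖ ≤ L * ‖y - z‖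
  taylor : ∀ i, ∀ y ∈ Metric.closedBall x₀ r, ∀ z ∈ Metric.closedBall x₀ r,
    |F i z - F i y - inner ℝ (gradient (F i) y) (z - y)| ≤ L * ‖z - y‖ ^ 2
  sum_abs_le : ∀ y ∈ Metric.closedBall x₀ r, ∀ c : ι → ℝ, ∑ i, c i = 0 →
    ∑ i, |c i| ≤ C * ‖∑ i, c i • gradient (F i) y‖

theorem IsStrongC2MaxFunction.exists_hasUniformBounds {E : Type*} [NormedAddCommGroup E]
    [InnerProductSpace ℝ E] [FiniteDimensional ℝ E] [CompleteSpace E] {ι : Type*} [Fintype ι]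
    {f : E → ℝ} {F : ι → E → ℝ} {x₀ : E} (hf : IsStrongC2MaxFunction f F x₀) :
    ∃ r L C : ℝ, 0 < r ∧ HasUniformBounds f F x₀ r L C := by
  obtain ⟨L, hL, hbd⟩ := exists_lipschitz_and_taylor_bound hf.smooth x₀ 1
  obtain ⟨C, hC, hcoef⟩ := hf.affineIndependent.exists_sum_abs_le
  obtain ⟨s, hs, hmax⟩ := Metric.eventually_nhds_iff_ball.1 hf.eq_max.eventually_nhds
  set r := min (min 1 (s / 2)) (1 / (2 * C * L)) with hr
  have hr0 : 0 < r := by positivity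
  have hr1 : r ≤ 1 := (min_le_left _ _).trans (min_le_left _ _)
  have hrs : r < s := ((min_le_left _ _).trans (min_le_right _ _)).trans_lt (by linarith)
  have hrC : L * r ≤ 1 / (2 * C) := by
    have h : r ≤ 1 / (2 * C * L) := min_le_right _ _
    calc L * r ≤ L * (1 / (2 * C * L)) := mul_le_mul_of_nonneg_left h hL.le
      _ = 1 / (2 * C) := by field_simp
  have hsub : Metric.closedBall x₀ r ⊆ Metric.closedBall x₀ 1 :=
    Metric.closedBall_subset_closedBall hr1
  refine ⟨r, L, 2 * C, hr0, hf.smooth, hL, by positivity,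
    fun y hy => hmax y (Metric.closedBall_subset_ball hrs hy),
    fun i y hy z hz => (hbd i y (hsub hy) z (hsub hz)).1,
    fun i y hy z hz => (hbd i y (hsub hy) z (hsub hz)).2.1,
    fun i y hy z hz => (hbd i y (hsub hy) z (hsub hz)).2.2, fun y hy c hc => ?_⟩
  refine sum_abs_le_of_norm_sub_le hC hcoef (fun i => ?_) c hc
  refine ((hbd i x₀ (Metric.mem_closedBall_self zero_le_one) y (hsub hy)).2.1.trans ?_).trans hrC
  rw [Metric.mem_closedBall, dist_comm, dist_eq_norm] at hy
  exact mul_le_mul_of_nonneg_left hy hL.le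

section UniformBounds

variable {E : Type*} [NormedAddCommGroup E] [InnerProductSpace ℝ E]
  [CompleteSpace E] {ι : Type*} [Fintype ι] {f : E → ℝ} {F : ι → E → ℝ} {x₀ : E} {r L C : ℝ}

theorem HasUniformBounds.affineIndependent (h : HasUniformBounds f F x₀ r L C) {y : E}
    (hy : y ∈ Metric.closedBall x₀ r) : AffineIndependent ℝ fun i => gradient (F i) y :=
  affineIndependent_of_sum_abs_le (h.sum_abs_le y hy)

/-- Expanding the displacement `x - p` in the gradients, by the Lagrange condition, shows that it is
almost orthogonal to `q - p` if the functions almost agree at `q`. -/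
theorem HasUniformBounds.inner_sub_sub_le [FiniteDimensional ℝ E]
    (h : HasUniformBounds f F x₀ r L C) {x p q : E}
    (hp : IsNearestPoint (activeManifold F) x p) (hpr : p ∈ Metric.closedBall x₀ r)
    (hqr : q ∈ Metric.closedBall x₀ r) {D : ℝ} (hD : ∀ i j, |F i q - F j q| ≤ D) :
    inner ℝ (x - p) (q - p) ≤ C * ‖x - p‖ * (D + L * ‖q - p‖ ^ 2) := by
  obtain ⟨c, hc0, hc⟩ := mem_vectorSpan_range_iff_exists_sum.1
    (hp.sub_mem_vectorSpan h.smooth (h.affineIndependent hpr))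
  have hcC := h.sum_abs_le p hpr c hc0
  rw [hc] at hcC
  rcases isEmpty_or_nonempty ι with hι | ⟨⟨k⟩⟩
  · have hz : x - p = 0 := by rw [← hc]; simp
    simp [hz]
  have hD0 : 0 ≤ D := (abs_nonneg _).trans (hD k k)
  have h1 : inner ℝ (x - p) (q - p)
      = ∑ i, c i * (inner ℝ (gradient (F i) p) (q - p) - (F k q - F k p)) := by
    simp_rw [mul_sub (c _) (inner ℝ _ _), Finset.sum_sub_distrib, ← Finset.sum_mul, hc0]
    rw [← hc, sum_inner]
    simp [inner_smul_left]
  have h2 : ∀ i, c i * (inner ℝ (gradient (F i) p) (q - p) - (F k q - F k p))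
      ≤ |c i| * (D + L * ‖q - p‖ ^ 2) := by
    intro i
    refine (le_abs_self _).trans ?_
    rw [abs_mul]
    refine mul_le_mul_of_nonneg_left ?_ (abs_nonneg _)
    have h3 := h.taylor i p hpr q hqr
    have h4 := hD i k
    have h5 := hp.1 i k
    rw [abs_le] at *
    constructor <;> linarith
  rw [h1]
  refine (Finset.sum_le_sum fun i _ => h2 i).trans ?_
  rw [← Finset.sum_mul]
  have := h.lipschitz_pos
  exact mul_le_mul_of_nonneg_right hcC (by positivity)

theorem HasUniformBounds.isNearestPoint_unique [FiniteDimensional ℝ E]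
    (h : HasUniformBounds f F x₀ r L C) {x p q : E}
    (hp : IsNearestPoint (activeManifold F) x p) (hpr : p ∈ Metric.closedBall x₀ r)
    (hq : IsNearestPoint (activeManifold F) x q) (hqr : q ∈ Metric.closedBall x₀ r)
    (hx : 2 * (C * L) * ‖x - p‖ < 1) : q = p := by
  have h1 := h.inner_sub_sub_le hp hpr hqr (D := 0)
    (fun i j => by rw [hq.1 i j, sub_self, abs_zero])
  have h2 : ‖x - q‖ = ‖x - p‖ := le_antisymm (hq.2 p hp.1) (hp.2 q hq.1)
  have h3 : ‖x - q‖ ^ 2 = ‖x - p‖ ^ 2 - 2 * inner ℝ (x - p) (q - p) + ‖q - p‖ ^ 2 := by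
    rw [← norm_sub_sq_real, sub_sub_sub_cancel_right]
  rw [h2] at h3
  have h4 : ‖q - p‖ ^ 2 * (1 - 2 * (C * L) * ‖x - p‖) ≤ 0 := by linarith
  have h5 : ‖q - p‖ ^ 2 ≤ 0 := nonpos_of_mul_nonpos_left h4 (by linarith)
  have h6 : ‖q - p‖ = 0 := by nlinarith [norm_nonneg (q - p)]
  exact sub_eq_zero.1 (norm_eq_zero.1 h6)

/-- Near the active manifold, the distance to it is controlled by the differences of the functions
that define it. -/
theorem HasUniformBounds.norm_sub_le_of_isNearestPoint [FiniteDimensional ℝ E]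
    (h : HasUniformBounds f F x₀ r L C)
    {x p : E} (hp : IsNearestPoint (activeManifold F) x p) (hpr : p ∈ Metric.closedBall x₀ r)
    (hxr : x ∈ Metric.closedBall x₀ r) (hx : 2 * (C * L) * ‖x - p‖ < 1)
    {D : ℝ} (hD0 : 0 ≤ D) (hD : ∀ i j, |F i x - F j x| ≤ D) : ‖x - p‖ ≤ 2 * C * D := by
  have h1 := h.inner_sub_sub_le hp hpr hxr hD
  rw [real_inner_self_eq_norm_sq] at h1
  have hC := h.coeff_pos
  rcases (norm_nonneg (x - p)).eq_or_lt with h0 | h0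
  · rw [← h0]
    positivity
  · have h2 : ‖x - p‖ ≤ C * (D + L * ‖x - p‖ ^ 2) := by
      refine le_of_mul_le_mul_right ?_ h0
      nlinarith
    nlinarith

/-! ### Clarke and Goldstein subdifferentials of a maximum -/

theorem isClosed_setOf_forall_le {X ι : Type*} [TopologicalSpace X] {F : ι → X → ℝ}
    (hF : ∀ i, Continuous (F i)) (i : ι) : IsClosed {y | ∀ j, F j y ≤ F i y} := by
  simp only [ofPred_forall]
  exact isClosed_iInter fun j => isClosed_le (hF j) (hF i)

/-- The gradients of the active functions are exactly the limiting gradients. At a point of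
differentiability of `f`, the gradient of `f` is that of any active function. Conversely, affine
independence of the gradients provides a direction along which one chosen active function dominates
all the others, so that `f` coincides with it there. -/
theorem HasUniformBounds.mem_limitingGradients_iff [FiniteDimensional ℝ E]
    (h : HasUniformBounds f F x₀ r L C) {y v : E}
    (hy : y ∈ Metric.closedBall x₀ r) :
    v ∈ limitingGradients f y ↔ ∃ i, (∀ j, F j y ≤ F i y) ∧ gradient (F i) y = v := by
  constructor
  · rintro ⟨z, u, hzu, hz, hu⟩
    have h1 : ∀ᶠ n in atTop, ∃ i, (∀ j, F j (z n) ≤ F i (z n)) ∧ gradient (F i) (z n) = u n := by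
      filter_upwards [hz.eventually (h.eventually_isGreatest y hy).eventually_nhds] with n hn
      obtain ⟨i, hi⟩ := hn.self_of_nhds.1
      beta_reduce at hi
      refine ⟨i, fun j => hi ▸ hn.self_of_nhds.2 (mem_range_self j), ?_⟩
      have hmin : IsLocalMin (fun q => f q - F i q) (z n) := by
        filter_upwards [hn] with q hq
        rw [hi, sub_self]
        exact sub_nonneg.2 (hq.2 (mem_range_self i))
      have hd := hmin.hasFDerivAt_eq_zero ((hzu n).hasFDerivAt.sub
        ((h.smooth i).hasGradientAt_gradient (z n)).hasFDerivAt)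
      rw [← map_sub, LinearIsometryEquiv.map_eq_zero_iff, sub_eq_zero] at hd
      exact hd.symm
    obtain ⟨i, hi⟩ : ∃ i, ∃ᶠ n in atTop,
        (∀ j, F j (z n) ≤ F i (z n)) ∧ gradient (F i) (z n) = u n := by
      by_contra hcon
      simp only [not_exists, not_frequently] at hcon
      obtain ⟨n, hn, i, hi⟩ := ((eventually_all.2 hcon).and h1).exists
      exact hn i hi
    have hcl : IsClosed {q : E × E | (∀ j, F j q.1 ≤ F i q.1) ∧ gradient (F i) q.1 = q.2} := by
      refine IsClosed.and ?_ (isClosed_eq ?_ continuous_snd)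
      · exact (isClosed_setOf_forall_le (fun j => (h.smooth j).continuous) i).preimage
          continuous_fst
      · exact (h.smooth i).contDiff_gradient.continuous.comp continuous_fst
    exact ⟨i, hcl.mem_of_frequently_of_tendsto (x := (y, v)) hi (hz.prodMk_nhds hu)⟩
  · rintro ⟨i, hi, rfl⟩
    classical
    obtain ⟨d, hd⟩ := (h.affineIndependent hy).exists_inner_sub_inner_eq (Pi.single i (1 : ℝ))
    have hline : HasDerivAt (fun t : ℝ => y + t • d) d 0 := by
      simpa using ((hasDerivAt_id (0 : ℝ)).smul_const d).const_add y
    have htend : Tendsto (fun t : ℝ => y + t • d) (𝓝[>] 0) (𝓝 y) := by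
      have := hline.continuousAt.tendsto.mono_left (nhdsWithin_le_nhds (s := Ioi 0))
      simpa using this
    have hdom : ∀ j, ∀ᶠ t in 𝓝[>] (0 : ℝ), j ≠ i → F j (y + t • d) < F i (y + t • d) := by
      intro j
      rcases eq_or_ne j i with rfl | hji
      · simp
      have hder : ∀ k, HasDerivAt (fun t : ℝ => F k (y + t • d))
          (inner ℝ (gradient (F k) y) d) 0 := by
        intro k
        have h1 : HasGradientAt (F k) (gradient (F k) y) (y + (0 : ℝ) • d) := by
          simpa using (h.smooth k).hasGradientAt_gradient y
        have := h1.hasFDerivAt.comp_hasDerivAt (0 : ℝ) hline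
        rwa [InnerProductSpace.toDual_apply_apply] at this
      have h1 := ((hder i).sub (hder j)).tendsto_slope_zero_right
      rw [hd i j] at h1
      simp only [Pi.single_eq_same, Pi.single_eq_of_ne hji, sub_zero] at h1
      filter_upwards [h1.eventually (lt_mem_nhds zero_lt_one), self_mem_nhdsWithin] with t ht ht0 _
      rw [smul_eq_mul, mul_pos_iff_of_pos_left (inv_pos.2 ht0)] at ht
      have := hi j
      simp at ht
      linarith
    have hgrad : ∀ᶠ t in 𝓝[>] (0 : ℝ),
        HasGradientAt f (gradient (F i) (y + t • d)) (y + t • d) := by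
      filter_upwards [eventually_all.2 hdom,
        htend.eventually (h.eventually_isGreatest y hy).eventually_nhds] with t ht htm
      refine ((h.smooth i).hasGradientAt_gradient _).congr_of_eventuallyEq ?_
      have h2 : ∀ᶠ z in 𝓝 (y + t • d), ∀ j, j ≠ i → F j z < F i z := by
        refine eventually_all.2 fun j => ?_
        rcases eq_or_ne j i with rfl | hji
        · simp
        filter_upwards [(h.smooth j).continuous.continuousAt.eventually_lt
          (h.smooth i).continuous.continuousAt (ht j hji)] with z hz _ using hz
      filter_upwards [h2, htm] with z hz hzm
      obtain ⟨j, hj⟩ := hzm.1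
      rcases eq_or_ne j i with rfl | hji
      · exact hj.symm
      · exact absurd (hzm.2 (mem_range_self i)) (not_le.2 (hj ▸ hz j hji))
    obtain ⟨t, ht, htg⟩ := exists_seq_forall_of_frequently hgrad.frequently
    exact ⟨fun n => y + t n • d, _, htg, htend.comp ht,
      ((h.smooth i).contDiff_gradient.continuous.tendsto y).comp (htend.comp ht)⟩

theorem HasUniformBounds.clarkeSubdifferential_eq [FiniteDimensional ℝ E]
    (h : HasUniformBounds f F x₀ r L C) {y : E}
    (hy : y ∈ Metric.closedBall x₀ r) :
    clarkeSubdifferential f y = convexHull ℝ (limitingGradients f y) := by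
  have hfin : (limitingGradients f y).Finite := by
    refine (finite_range fun i => gradient (F i) y).subset fun v hv => ?_
    obtain ⟨i, -, rfl⟩ := (h.mem_limitingGradients_iff hy).1 hv
    exact mem_range_self i
  exact (hfin.isClosed_convexHull ℝ).closure_eq

/-- The gradients of one function of a family at the points of a closed ball where it attains the
maximum of the family. -/
def activeGradients {E : Type*} [NormedAddCommGroup E] [InnerProductSpace ℝ E] [CompleteSpace E]
    {ι : Type*} (F : ι → E → ℝ) (ε : ℝ) (x : E) (i : ι) : Set E :=
  gradient (F i) '' {y ∈ Metric.closedBall x ε | ∀ j, F j y ≤ F i y}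

theorem HasUniformBounds.goldsteinSubdifferential_eq [FiniteDimensional ℝ E]
    (h : HasUniformBounds f F x₀ r L C)
    {x : E} {ε : ℝ} (hx : Metric.closedBall x ε ⊆ Metric.closedBall x₀ r) :
    goldsteinSubdifferential f ε x = convexHull ℝ (⋃ i, activeGradients F ε x i) := by
  apply Subset.antisymm
  · refine convexHull_min (iUnion₂_subset fun y hy => ?_) (convex_convexHull ℝ _)
    rw [h.clarkeSubdifferential_eq (hx hy)]
    refine convexHull_mono fun v hv => ?_
    obtain ⟨i, hi, rfl⟩ := (h.mem_limitingGradients_iff (hx hy)).1 hv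
    exact mem_iUnion.2 ⟨i, y, ⟨hy, hi⟩, rfl⟩
  · refine convexHull_mono (iUnion_subset fun i => ?_)
    rintro _ ⟨y, ⟨hy, hi⟩, rfl⟩
    refine mem_biUnion hy ?_
    rw [h.clarkeSubdifferential_eq (hx hy)]
    exact subset_convexHull ℝ _ ((h.mem_limitingGradients_iff (hx hy)).2 ⟨i, hi, rfl⟩)

/-- The variational inequality for the shortest vector of a convex set. -/
theorem Convex.inner_sub_nonneg_of_forall_norm_le {E : Type*} [NormedAddCommGroup E]
    [InnerProductSpace ℝ E] {s : Set E} (hs : Convex ℝ s) {g : E} (hg : g ∈ s)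
    (hmin : ∀ v ∈ s, ‖g‖ ≤ ‖v‖) {v : E} (hv : v ∈ s) : 0 ≤ inner ℝ g (v - g) := by
  have hne : Nonempty s := ⟨⟨g, hg⟩⟩
  have h1 : ‖(0 : E) - g‖ = ⨅ w : s, ‖(0 : E) - w‖ := by
    simp only [zero_sub, norm_neg]
    exact le_antisymm (le_ciInf fun w => hmin w w.2)
      (ciInf_le (f := fun w : s => ‖(w : E)‖) ⟨0, by rintro _ ⟨w, rfl⟩; exact norm_nonneg _⟩
        ⟨g, hg⟩)
  have h2 := (norm_eq_iInf_iff_real_inner_le_zero hs hg).1 h1 v hv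
  rw [zero_sub, inner_neg_left] at h2
  linarith

theorem HasUniformBounds.existsUnique_isGoldsteinSubgradient [FiniteDimensional ℝ E]
    (h : HasUniformBounds f F x₀ r L C) {x : E} {ε : ℝ} (hε : 0 ≤ ε)
    (hx : Metric.closedBall x ε ⊆ Metric.closedBall x₀ r) :
    ∃! g, IsGoldsteinSubgradient f ε x g := by
  have hconv : Convex ℝ (goldsteinSubdifferential f ε x) := convex_convexHull ℝ _
  have hcomp : IsCompact (goldsteinSubdifferential f ε x) := by
    rw [h.goldsteinSubdifferential_eq hx]
    refine (isCompact_iUnion fun i => IsCompact.image ?_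
      (h.smooth i).contDiff_gradient.continuous).convexHull_of_finiteDimensional
    exact (isCompact_closedBall x ε).inter_right
      (isClosed_setOf_forall_le (fun j => (h.smooth j).continuous) i)
  have hne : (goldsteinSubdifferential f ε x).Nonempty := by
    rw [h.goldsteinSubdifferential_eq hx, convexHull_nonempty_iff]
    have hxx := Metric.mem_closedBall_self (x := x) hε
    have hm := (h.eventually_isGreatest x (hx hxx)).self_of_nhds
    obtain ⟨i, hi⟩ := hm.1
    beta_reduce at hi
    exact ⟨_, mem_iUnion.2 ⟨i, x, ⟨hxx, fun j => hi ▸ hm.2 (mem_range_self j)⟩, rfl⟩⟩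
  obtain ⟨g, hg, hmin⟩ := hcomp.exists_isMinOn hne continuous_norm.continuousOn
  refine ⟨g, ⟨hg, fun v hv => hmin hv⟩, fun g' hg' => ?_⟩
  have h1 := hconv.inner_sub_nonneg_of_forall_norm_le hg (fun v hv => hmin hv) hg'.1
  have h2 := hconv.inner_sub_nonneg_of_forall_norm_le hg'.1 hg'.2 hg
  have h3 : ‖g' - g‖ ^ 2 = -inner ℝ g' (g - g') - inner ℝ g (g' - g) := by
    rw [← real_inner_self_eq_norm_sq]
    simp only [inner_sub_left, inner_sub_right]
    ring
  have h4 : ‖g' - g‖ = 0 := by nlinarith [norm_nonneg (g' - g)]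
  exact sub_eq_zero.1 (norm_eq_zero.1 h4)

theorem HasUniformBounds.norm_sub_gradient_le (h : HasUniformBounds f F x₀ r L C) {x : E} {ε : ℝ}
    (hx : Metric.closedBall x ε ⊆ Metric.closedBall x₀ r) {q : E}
    (hq : q ∈ Metric.closedBall x₀ r) {i : ι} {G : E}
    (hG : G ∈ convexHull ℝ (activeGradients F ε x i)) :
    ‖G - gradient (F i) q‖ ≤ L * (‖x - q‖ + ε) := by
  rw [← dist_eq_norm, ← Metric.mem_closedBall]
  refine convexHull_min ?_ (convex_closedBall _ _) hG
  rintro _ ⟨y, ⟨hy, -⟩, rfl⟩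
  rw [Metric.mem_closedBall, dist_eq_norm]
  refine (h.lipschitz_gradient i y (hx hy) q hq).trans
    (mul_le_mul_of_nonneg_left ?_ h.lipschitz_pos.le)
  rw [Metric.mem_closedBall, dist_eq_norm] at hy
  have := norm_add_le (y - x) (x - q)
  rw [sub_add_sub_cancel] at this
  linarith

end UniformBounds

/-! ### The shortest vector of a Goldstein subdifferential -/

/-- If all weights of the shortest vector of a convex set, as a combination of points of the set,
are positive, then the vector has the same inner product with all those points, because the weights
can be perturbed in both directions. -/
theorem Convex.inner_sum_eq_zero_of_forall_norm_le {E : Type*} [NormedAddCommGroup E]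
    [InnerProductSpace ℝ E] {ι : Type*} [Fintype ι] {s : Set E} (hs : Convex ℝ s) {g : E}
    (hg : g ∈ s) (hmin : ∀ v ∈ s, ‖g‖ ≤ ‖v‖) {w : ι → ℝ} {G : ι → E} (hw : ∀ i, 0 < w i)
    (hw1 : ∑ i, w i = 1) (hG : ∀ i, G i ∈ s) (hsum : ∑ i, w i • G i = g) {c : ι → ℝ}
    (hc : ∑ i, c i = 0) : inner ℝ g (∑ i, c i • G i) = 0 := by
  have key : ∀ c : ι → ℝ, ∑ i, c i = 0 → 0 ≤ inner ℝ g (∑ i, c i • G i) := by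
    intro c hc
    have hev : ∀ᶠ t in 𝓝[>] (0 : ℝ), ∀ i, 0 ≤ w i + t * c i := by
      refine eventually_all.2 fun i => ?_
      have h1 : Tendsto (fun t : ℝ => w i + t * c i) (𝓝 0) (𝓝 (w i)) := by
        have : Continuous fun t : ℝ => w i + t * c i := by fun_prop
        simpa using this.tendsto 0
      filter_upwards [(h1.mono_left nhdsWithin_le_nhds).eventually (lt_mem_nhds (hw i))]
        with t ht using ht.le
    obtain ⟨t, ht, ht0⟩ := (hev.and self_mem_nhdsWithin).exists
    have hmem : ∑ i, (w i + t * c i) • G i ∈ s := by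
      refine hs.sum_mem (fun i _ => ht i) ?_ fun i _ => hG i
      rw [Finset.sum_add_distrib, ← Finset.mul_sum, hw1, hc, mul_zero, add_zero]
    have h1 := hs.inner_sub_nonneg_of_forall_norm_le hg hmin hmem
    simp_rw [add_smul, Finset.sum_add_distrib, hsum, add_sub_cancel_left, mul_smul,
      ← Finset.smul_sum, inner_smul_right] at h1
    exact nonneg_of_mul_nonneg_right h1 ht0
  refine le_antisymm ?_ (key c hc)
  have h := key (fun i => -c i) (by simp [hc])
  simpa [inner_neg_right] using h

/-- If vectors `G i` are close to the vectors `a i`, then a convex combination `g` of the `G i` that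
has the same inner product with all of them is close to the projection `v` of the `a i` on the
orthogonal complement of their differences: the component of `g` in the complement is compared with
`v`, and the other component is small since the `a i` almost inherit the orthogonality. -/
theorem norm_sub_starProjection_le {E : Type*} [NormedAddCommGroup E] [InnerProductSpace ℝ E]
    [FiniteDimensional ℝ E] {ι : Type*} [Fintype ι] {a G : ι → E} {C ρ : ℝ} (hC : 0 ≤ C)
    (ha : ∀ c : ι → ℝ, ∑ i, c i = 0 → ∑ i, |c i| ≤ C * ‖∑ i, c i • a i‖)
    (hG : ∀ i, ‖G i - a i‖ ≤ ρ) {w : ι → ℝ} (hw : ∀ i, 0 ≤ w i) (hw1 : ∑ i, w i = 1) {g : E}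
    (hsum : ∑ i, w i • G i = g)
    (hstat : ∀ c : ι → ℝ, ∑ i, c i = 0 → inner ℝ g (∑ i, c i • G i) = 0) (k : ι) :
    ‖g - (vectorSpan ℝ (range a))ᗮ.starProjection (a k)‖ ≤ (1 + C * ‖g‖) * ρ := by
  set N := vectorSpan ℝ (range a) with hN
  have hρ : 0 ≤ ρ := (norm_nonneg _).trans (hG k)
  have hproj : ∀ i, Nᗮ.starProjection (a i) = Nᗮ.starProjection (a k) := by
    intro i
    rw [← sub_eq_zero, ← map_sub, Submodule.starProjection_apply_eq_zero_iff]
    exact N.le_orthogonal_orthogonal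
      (vsub_mem_vectorSpan ℝ (mem_range_self i) (mem_range_self k))
  have htan : ‖Nᗮ.starProjection g - Nᗮ.starProjection (a k)‖ ≤ ρ := by
    have h1 : Nᗮ.starProjection g - Nᗮ.starProjection (a k)
        = ∑ i, w i • Nᗮ.starProjection (G i - a i) := by
      simp_rw [map_sub, hproj, smul_sub, Finset.sum_sub_distrib, ← Finset.sum_smul, hw1, one_smul]
      rw [← hsum, map_sum]
      simp_rw [map_smul]
    rw [h1]
    calc ‖∑ i, w i • Nᗮ.starProjection (G i - a i)‖
        ≤ ∑ i, w i * ρ := by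
          refine (norm_sum_le _ _).trans (Finset.sum_le_sum fun i _ => ?_)
          rw [norm_smul, Real.norm_of_nonneg (hw i)]
          exact mul_le_mul_of_nonneg_left
            ((Submodule.norm_starProjection_apply_le _ _).trans (hG i)) (hw i)
      _ = ρ := by rw [← Finset.sum_mul, hw1, one_mul]
  have hnor : ‖N.starProjection g‖ ≤ C * ‖g‖ * ρ := by
    obtain ⟨c, hc0, hc⟩ := mem_vectorSpan_range_iff_exists_sum.1 (N.starProjection_apply_mem g)
    have hcC := ha c hc0
    rw [hc] at hcC
    have h1 : ‖N.starProjection g‖ ^ 2 = inner ℝ g (∑ i, c i • (a i - G i)) := by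
      simp_rw [smul_sub, Finset.sum_sub_distrib, inner_sub_right, hstat c hc0, hc, sub_zero]
      rw [← real_inner_self_eq_norm_sq, Submodule.inner_starProjection_left_eq_right,
        Submodule.starProjection_eq_self_iff.2 (N.starProjection_apply_mem g)]
    have h2 : ‖∑ i, c i • (a i - G i)‖ ≤ (∑ i, |c i|) * ρ := by
      rw [Finset.sum_mul]
      refine (norm_sum_le _ _).trans (Finset.sum_le_sum fun i _ => ?_)
      rw [norm_smul, Real.norm_eq_abs, norm_sub_rev]
      exact mul_le_mul_of_nonneg_left (hG i) (abs_nonneg _)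
    have h3 : ‖N.starProjection g‖ ^ 2 ≤ ‖g‖ * (C * ‖N.starProjection g‖ * ρ) := by
      rw [h1]
      exact (real_inner_le_norm _ _).trans (mul_le_mul_of_nonneg_left
        (h2.trans (mul_le_mul_of_nonneg_right hcC hρ)) (norm_nonneg _))
    rcases (norm_nonneg (N.starProjection g)).eq_or_lt with h0 | h0
    · rw [← h0]
      positivity
    · refine le_of_mul_le_mul_right ?_ h0
      nlinarith
  have hdec : g - Nᗮ.starProjection (a k)
      = N.starProjection g + (Nᗮ.starProjection g - Nᗮ.starProjection (a k)) := by
    rw [← add_sub_assoc, Submodule.starProjection_add_starProjection_orthogonal]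
  rw [hdec]
  refine (norm_add_le _ _).trans ?_
  linarith

/-- A short vector of a Goldstein subdifferential near the minimizer puts positive weight on every
function, because affine independence keeps the weights near those, all positive, with which zero is
a combination of the gradients at the minimizer. -/
theorem HasUniformBounds.exists_pos_weights {E : Type*} [NormedAddCommGroup E]
    [InnerProductSpace ℝ E] [FiniteDimensional ℝ E] [CompleteSpace E] {ι : Type*} [Fintype ι]
    {f : E → ℝ} {F : ι → E → ℝ} {x₀ : E} {r L C : ℝ} (h : HasUniformBounds f F x₀ r L C)
    (hr : 0 ≤ r) {l : ι → ℝ} (hl1 : ∑ i, l i = 1) (hl : ∑ i, l i • gradient (F i) x₀ = 0)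
    {x g : E} {ε : ℝ} (hx : Metric.closedBall x ε ⊆ Metric.closedBall x₀ r)
    (hg : g ∈ goldsteinSubdifferential f ε x)
    (hsmall : ∀ i, C * (‖g‖ + L * (‖x - x₀‖ + ε)) < l i) :
    ∃ (w : ι → ℝ) (G : ι → E), (∀ i, 0 < w i) ∧ ∑ i, w i = 1 ∧
      (∀ i, G i ∈ convexHull ℝ (activeGradients F ε x i)) ∧ ∑ i, w i • G i = g := by
  rw [h.goldsteinSubdifferential_eq hx] at hg
  obtain ⟨w, G, hw0, hw1, hG, hsum⟩ := exists_weights_of_mem_convexHull_iUnion hg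
  suffices hw : ∀ i, 0 < w i from ⟨w, G, hw, hw1, fun i => hG i (hw i), hsum⟩
  have hx₀ := Metric.mem_closedBall_self (x := x₀) hr
  have h1 := h.sum_abs_le x₀ hx₀ (fun i => l i - w i)
    (by rw [Finset.sum_sub_distrib, hl1, hw1, sub_self])
  have h2 : ‖∑ i, (l i - w i) • gradient (F i) x₀‖ ≤ ‖g‖ + L * (‖x - x₀‖ + ε) := by
    have h3 : ∑ i, (l i - w i) • gradient (F i) x₀
        = ∑ i, w i • (G i - gradient (F i) x₀) - g := by
      simp_rw [sub_smul, smul_sub, Finset.sum_sub_distrib, hl, hsum]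
      abel
    rw [h3]
    refine (norm_sub_le _ _).trans ?_
    rw [add_comm]
    refine add_le_add_right ?_ _
    calc ‖∑ i, w i • (G i - gradient (F i) x₀)‖
        ≤ ∑ i, w i * (L * (‖x - x₀‖ + ε)) := by
          refine (norm_sum_le _ _).trans (Finset.sum_le_sum fun i _ => ?_)
          rw [norm_smul, Real.norm_of_nonneg (hw0 i)]
          rcases (hw0 i).eq_or_lt with h0 | h0
          · rw [← h0, zero_mul, zero_mul]
          · exact mul_le_mul_of_nonneg_left (h.norm_sub_gradient_le hx hx₀ (hG i h0)) h0.le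
      _ = L * (‖x - x₀‖ + ε) := by rw [← Finset.sum_mul, hw1, one_mul]
  intro i
  have h4 := Finset.single_le_sum (f := fun j => |l j - w j|) (fun j _ => abs_nonneg _)
    (Finset.mem_univ i)
  have h5 := mul_le_mul_of_nonneg_left h2 h.coeff_pos.le
  have h6 := le_abs_self (l i - w i)
  have h7 := hsmall i
  beta_reduce at h4
  linarith

/-- If each function attains the maximum somewhere in a small ball, then all of them almost agree at
its centre. -/
theorem HasUniformBounds.abs_sub_le_of_activeGradients_nonempty {E : Type*}
    [NormedAddCommGroup E] [InnerProductSpace ℝ E] [CompleteSpace E] {ι : Type*} [Fintype ι]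
    {f : E → ℝ} {F : ι → E → ℝ} {x₀ : E} {r L C : ℝ} (h : HasUniformBounds f F x₀ r L C)
    {x : E} {ε : ℝ} (hε : 0 ≤ ε) (hx : Metric.closedBall x ε ⊆ Metric.closedBall x₀ r)
    (hne : ∀ i, (activeGradients F ε x i).Nonempty) (i j : ι) : |F i x - F j x| ≤ 2 * L * ε := by
  have key : ∀ i j, F j x - F i x ≤ 2 * L * ε := by
    intro i j
    obtain ⟨_, y, ⟨hy, hmax⟩, -⟩ := hne i
    have hxx := hx (Metric.mem_closedBall_self hε)
    have h1 := abs_le.1 (h.lipschitz i x hxx y (hx hy))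
    have h2 := abs_le.1 (h.lipschitz j x hxx y (hx hy))
    have h3 := hmax j
    rw [Metric.mem_closedBall, dist_comm, dist_eq_norm] at hy
    have h4 := mul_le_mul_of_nonneg_left hy h.lipschitz_pos.le
    linarith [h1.1, h2.2]
  rw [abs_le]
  constructor <;> linarith [key i j, key j i]

theorem mainTheorem5 {E : Type*} [NormedAddCommGroup E] [InnerProductSpace ℝ E]
    [FiniteDimensional ℝ E] [CompleteSpace E] {ι : Type*} [Finite ι]
    (f : E → ℝ) (F : ι → E → ℝ) (xbar : E)
    (hf : IsStrongC2MaxFunction f F xbar) (hmin : IsLocalMin f xbar) :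
    ∃ μ : ℝ, 0 < μ ∧ ∃ K δ : ℝ, 0 < δ ∧
      ∀ x : E, ‖x - xbar‖ < δ → ∀ ε : ℝ, 0 ≤ ε → ε < δ →
        (∃! g, IsGoldsteinSubgradient f ε x g) ∧
        (∃! p, IsNearestPoint (activeManifold F) x p) ∧
        ∀ p, IsNearestPoint (activeManifold F) x p →
          (∃! v, IsRiemannianGradient f (activeManifold F) p v) ∧
          ∀ g v, IsGoldsteinSubgradient f ε x g →
            IsRiemannianGradient f (activeManifold F) p v →
            ‖g‖ ≤ μ → ‖x - p‖ ≤ K * ε ∧ ‖g - v‖ ≤ K * ε := by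
  have := Fintype.ofFinite ι
  obtain ⟨r, L, C, hr, h⟩ := hf.exists_hasUniformBounds
  have hL := h.lipschitz_pos
  have hC := h.coeff_pos
  have hbar := Metric.mem_closedBall_self (x := xbar) hr.le
  obtain ⟨k, -⟩ := hf.eq_max.self_of_nhds.1
  have hne : Nonempty ι := ⟨k⟩
  have hlim : limitingGradients f xbar = range fun i => gradient (F i) xbar := by
    ext v
    rw [h.mem_limitingGradients_iff hbar]
    exact exists_congr fun i => and_iff_right fun j => (hf.active j i).le
  have hri := hf.nondegenerate
  rw [h.clarkeSubdifferential_eq hbar, hlim] at hri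
  obtain ⟨l, hl0, hl1, hl⟩ := exists_pos_weights_of_zero_mem_intrinsicInterior hri
  obtain ⟨m, hm⟩ := Finite.exists_min l
  -- With `‖g‖ ≤ μ`, the weights of `g` differ from those in `l` by at most half of the smallest.
  set μ := l m / (4 * C) with hμ
  have hμ0 : 0 < μ := div_pos (hl0 m) (by positivity)
  -- The three bounds keep all points considered in the ball of radius `r`, make nearest points
  -- unique, and make the gradients near `xbar` vary by at most `μ`.
  set δ := min (r / 2) (min (1 / (4 * (C * L))) (μ / (2 * L))) with hδ
  have hδ0 : 0 < δ := by positivity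
  have hδr : 2 * δ ≤ r := by
    have : δ ≤ r / 2 := min_le_left _ _
    linarith
  have hδC : 2 * (C * L) * δ < 1 := by
    have h1 : δ ≤ 1 / (4 * (C * L)) := (min_le_right _ _).trans (min_le_left _ _)
    rw [le_div_iff₀ (by positivity)] at h1
    nlinarith
  have hδμ : L * (δ + δ) ≤ μ := by
    have h1 : δ ≤ μ / (2 * L) := (min_le_right _ _).trans (min_le_right _ _)
    rw [le_div_iff₀ (by positivity)] at h1
    linarith
  set R := L * (4 * C * L + 1) with hR
  have hR0 : 0 < R := by positivity
  refine ⟨μ, hμ0, max (4 * C * L) ((1 + C * μ) * R), δ, hδ0, fun x hx ε hε hεδ => ?_⟩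
  have hball : Metric.closedBall x ε ⊆ Metric.closedBall xbar r := by
    refine Metric.closedBall_subset_closedBall' ?_
    rw [dist_eq_norm]
    linarith
  have hxr : x ∈ Metric.closedBall xbar r := hball (Metric.mem_closedBall_self hε)
  have hbarM : xbar ∈ activeManifold F := hf.active
  have hnear : ∀ p, IsNearestPoint (activeManifold F) x p →
      p ∈ Metric.closedBall xbar r ∧ 2 * (C * L) * ‖x - p‖ < 1 := by
    intro p hp
    have h1 := hp.2 xbar hbarM
    constructor
    · rw [Metric.mem_closedBall]
      have h2 := dist_triangle_left p xbar x
      rw [dist_eq_norm x p, dist_eq_norm x xbar] at h2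
      linarith
    · refine lt_of_le_of_lt ?_ hδC
      exact mul_le_mul_of_nonneg_left (h1.trans hx.le) (by positivity)
  refine ⟨h.existsUnique_isGoldsteinSubgradient hε hball, ?_, fun p hp => ?_⟩
  · obtain ⟨p, hp⟩ := exists_isNearestPoint_activeManifold
      (fun i => (hf.smooth i).continuous) ⟨xbar, hbarM⟩ x
    exact ⟨p, hp, fun q hq => h.isNearestPoint_unique hp (hnear p hp).1 hq (hnear q hq).1
      (hnear p hp).2⟩
  obtain ⟨hpr, hpx⟩ := hnear p hp
  have hriem := fun v => isRiemannianGradient_activeManifold_iff (v := v) h.smooth hp.1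
    (h.affineIndependent hpr) (h.eventually_isGreatest p hpr) k
  refine ⟨⟨_, (hriem _).2 rfl, fun v hv => (hriem v).1 hv⟩, fun g v hg hv hgμ => ?_⟩
  obtain ⟨w, G, hw, hw1, hG, hsum⟩ := h.exists_pos_weights hr.le hl1 hl hball hg.1 fun i => by
    have h1 : L * (‖x - xbar‖ + ε) ≤ μ :=
      (mul_le_mul_of_nonneg_left (by linarith) hL.le).trans hδμ
    have h2 : C * μ = l m / 4 := by rw [hμ]; field_simp
    have h3 : C * (‖g‖ + L * (‖x - xbar‖ + ε)) ≤ C * (μ + μ) :=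
      mul_le_mul_of_nonneg_left (by linarith) hC.le
    linarith [hl0 m, hm i]
  have hdist : ‖x - p‖ ≤ 4 * C * L * ε := by
    have h1 := h.norm_sub_le_of_isNearestPoint hp hpr hxr hpx (D := 2 * L * ε) (by positivity)
      (h.abs_sub_le_of_activeGradients_nonempty hε hball
        fun i => convexHull_nonempty_iff.1 ⟨_, hG i⟩)
    linarith
  refine ⟨hdist.trans (mul_le_mul_of_nonneg_right (le_max_left _ _) hε), ?_⟩
  have hGp : ∀ i, ‖G i - gradient (F i) p‖ ≤ R * ε := by
    intro i
    refine (h.norm_sub_gradient_le hball hpr (hG i)).trans ?_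
    rw [hR, mul_assoc]
    exact mul_le_mul_of_nonneg_left (by linarith) hL.le
  have hGmem : ∀ i, G i ∈ goldsteinSubdifferential f ε x := by
    intro i
    rw [h.goldsteinSubdifferential_eq hball]
    exact convexHull_mono (subset_iUnion _ i) (hG i)
  have hstat := fun (c : ι → ℝ) (hc : ∑ i, c i = 0) =>
    (convex_convexHull ℝ _ : Convex ℝ (goldsteinSubdifferential f ε x))
      |>.inner_sum_eq_zero_of_forall_norm_le hg.1 hg.2 hw hw1 hGmem hsum hc
  rw [(hriem v).1 hv]
  refine (norm_sub_starProjection_le hC.le (h.sum_abs_le p hpr) hGp (fun i => (hw i).le) hw1 hsum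
    hstat k).trans ?_
  rw [← mul_assoc]
  refine mul_le_mul_of_nonneg_right (le_trans ?_ (le_max_right _ _)) hε
  exact mul_le_mul_of_nonneg_right (by linarith [mul_le_mul_of_nonneg_left hgμ hC.le]) hR0.le
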